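/- **Conventions.** For a locally compact Hausdorff space $X$, $C_0(X)$ denotes the complex-valued continuous functions on $X$ vanishing at infinity, with the supremum norm $\|\cdot\|_X$. A *function algebra* on $X$ is a closed complex subalgebra $\mathcal A$ of $C_0(X)$ such that for distinct $x,y\in X$ some $f\in\mathcal A$ has $f(x)\ne f(y)$, and for each $x\in X$ some $g\in\mathcal A$ has $g(x)\neq 0$. Its *Choquet boundary* ${\rm Ch}(\mathcal A)$ is the set of $x\in X$ for which the evaluation functional $e_x:f\mapsto f(x)$ is an extreme point of the closed unit ball of $\mathcal A^*$. For $A\subseteq C_0(X)$, $\delta(A)$ is the set of *strong boundary points* of $A$: those $x\in X$ such that for every $\epsilon>0$ and every neighborhood $V$ of $x$ there is $f\in A$ with $f(x)=1=\|f\|_X$ and $|f|<\epsilon$ on $X\setminus V$. Put $|A|=\{|f|:f\in A\}$, $M(f)=\{x\in X:|f(x)|=\|f\|_X\}$ and, for $x\in X$, $r>0$, $F^r_{x}(A)=\{f\in A:|f(x)|=r=\|f\|_X\}$. Let $\varphi:\mathbb C\times\mathbb C\to[0,\infty)$ be a continuous map satisfying (inc) if $|s_1|\le|s_2|$ then $\varphi(s_1,t)\le\varphi(s_2,t)$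 and $\varphi(t,s_1)\le\varphi(t,s_2)$ for all $t\in\mathbb C$; if $|s_1|<|s_2|$ then $\varphi(s_1,t)<\varphi(s_2,t)$ and $\varphi(t,s_1)<\varphi(t,s_2)$ for all $t\in\mathbb C\setminus\{0\}$. For bounded continuous $f,g$ put $\varphi(f,g)(x)=\varphi(f(x),g(x))$, $\rho_+(f,g)=\|\varphi(f,g)\|+\|\varphi(g,f)\|$ and $\rho_{\max}(f,g)=\max(\|\varphi(f,g)\|,\|\varphi(g,f)\|)$, with supremum norms. **Theorem.** Let $X,Y$ be locally compact Hausdorff spaces. Let each of $A\subseteq C_0(X)$ and $B\subseteq C_0(Y)$ be either a subset closed under multiplication or the positive part $M_+=\{f\in M: f\ge 0\}$ of a subset $M$ closed under multiplication, and let $A$ and $B$ be closed under multiplication by strictly positive scalars. Suppose that $\delta(A)={\rm Ch}(\mathcal A)$ and $\delta(B)={\rm Ch}(\mathcal B)$ for some function algebras $\mathcal A$ on $X$ and $\mathcal B$ on $Y$ with $|A|\subseteq|\mathcal A|$ and $|B|\subseteq|\mathcal B|$. Let $\rho\in\{\rho_+,\rho_{\max}\}$ and let $T:A\to B$ be a surjective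 map with $$\rho(Tf,Tg)=\rho(f,g)\qquad(f,g\in A).$$ Then $T$ induces a bijection $\Phi:{\rm Ch}(\mathcal B)\to{\rm Ch}(\mathcal A)$, in the sense that for all $y\in{\rm Ch}(\mathcal B)$ and $r>0$ $$\Big(\bigcap_{f\in A,\ Tf\in F^r_{y}(B)}M(f)\Big)\cap{\rm Ch}(\mathcal A)=\{\Phi(y)\},\qquad \Big(\bigcap_{f\in F^r_{\Phi(y)}(A)}M(Tf)\Big)\cap{\rm Ch}(\mathcal B)=\{y\}.$$ Moreover: (i) if $\rho=\rho_{\max}$, then $\Phi$ is a homeomorphism and $|Tf(y)|=|f(\Phi(y))|$ for all $f\in A$ and $y\in{\rm Ch}(\mathcal B)$; (ii) if $\rho=\rho_+$ and either (a) $\varphi(t,0)=0=\varphi(0,t)$ for all $t\ge0$, or (b) for all $a>0$, $\varphi(t,a)\to\infty$ and $\varphi(a,t)\to\infty$ as $t\to\infty$, then $\Phi$ is a homeomorphism and $|Tf(y)|=|f(\Phi(y))|$ for all $f\in A$ and $y\in{\rm Ch}(\mathcal B)$. -/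

import Mathlib

open scoped ZeroAtInfty BoundedContinuousFunction

namespace NormPreserving

section TwoVariable

variable {X : Type*} [TopologicalSpace X]

/-- The increasing property (inc): `φ` is increasing in modulus in each variable, and strictly
increasing in modulus in each variable when the other variable is non-zero. -/
structure IsInc (φ : C(ℂ × ℂ, ℝ)) : Prop where
  le_left : ∀ s₁ s₂ t : ℂ, ‖s₁‖ ≤ ‖s₂‖ → φ (s₁, t) ≤ φ (s₂, t)
  le_right : ∀ s₁ s₂ t : ℂ, ‖s₁‖ ≤ ‖s₂‖ → φ (t, s₁) ≤ φ (t, s₂)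
  lt_left : ∀ s₁ s₂ t : ℂ, t ≠ 0 → ‖s₁‖ < ‖s₂‖ → φ (s₁, t) < φ (s₂, t)
  lt_right : ∀ s₁ s₂ t : ℂ, t ≠ 0 → ‖s₁‖ < ‖s₂‖ → φ (t, s₁) < φ (t, s₂)

theorem exists_bound (φ : C(ℂ × ℂ, ℝ)) (f g : X →ᵇ ℂ) :
    ∃ C : ℝ, ∀ x, ‖φ (f x, g x)‖ ≤ C := by
  have hK : IsCompact (Metric.closedBall (0 : ℂ) ‖f‖ ×ˢ Metric.closedBall (0 : ℂ) ‖g‖) :=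
    (isCompact_closedBall _ _).prod (isCompact_closedBall _ _)
  obtain ⟨C, hC⟩ := hK.exists_bound_of_continuousOn φ.continuous.continuousOn
  refine ⟨C, fun x => hC _ ⟨?_, ?_⟩⟩
  · simpa using f.norm_coe_le_norm x
  · simpa using g.norm_coe_le_norm x

/-- The bounded continuous function `φ(f, g)`, `x ↦ φ (f x, g x)`. -/
noncomputable def comp₂ (φ : C(ℂ × ℂ, ℝ)) (f g : X →ᵇ ℂ) : X →ᵇ ℝ :=
  BoundedContinuousFunction.ofNormedAddCommGroup (fun x => φ (f x, g x))
    (φ.continuous.comp (f.continuous.prodMk g.continuous))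
    (exists_bound φ f g).choose (exists_bound φ f g).choose_spec

/-- `ρ₊(f, g) = ‖φ(f, g)‖ + ‖φ(g, f)‖`. -/
noncomputable def rhoPlus (φ : C(ℂ × ℂ, ℝ)) (f g : X →ᵇ ℂ) : ℝ :=
  ‖comp₂ φ f g‖ + ‖comp₂ φ g f‖

/-- `ρ_max(f, g) = max (‖φ(f, g)‖, ‖φ(g, f)‖)`. -/
noncomputable def rhoMax (φ : C(ℂ × ℂ, ℝ)) (f g : X →ᵇ ℂ) : ℝ :=
  max ‖comp₂ φ f g‖ ‖comp₂ φ g f‖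

/-- The two choices of `ρ`. -/
inductive RhoKind
  | plus
  | max

/-- `ρ(f, g)`, where `ρ` is one of `ρ₊`, `ρ_max`. -/
noncomputable def rho (k : RhoKind) (φ : C(ℂ × ℂ, ℝ)) (f g : X →ᵇ ℂ) : ℝ :=
  match k with
  | RhoKind.plus => rhoPlus φ f g
  | RhoKind.max => rhoMax φ f g

end TwoVariable

section Boundaries

variable {X : Type*} [TopologicalSpace X]

/-- A function algebra on `X`: a closed (not necessarily unital) complex subalgebra of `C₀(X)`
that strongly separates the points of `X`. -/
structure IsFunctionAlgebra (𝒜 : NonUnitalSubalgebra ℂ C₀(X, ℂ)) : Prop where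
  isClosed : IsClosed (𝒜 : Set C₀(X, ℂ))
  separates : ∀ x y : X, x ≠ y → ∃ f ∈ 𝒜, f x ≠ f y
  nonvanishing : ∀ x : X, ∃ f ∈ 𝒜, f x ≠ 0

/-- The dual of a complex normed space `E`, with the operator norm. -/
abbrev NormedDual (E : Type*) [NormedAddCommGroup E] [NormedSpace ℂ E] : Type _ :=
  StrongDual ℂ E

/-- The evaluation functional `e_x : f ↦ f x` on a subspace of `C₀(X)`. -/
noncomputable def evalFunctional (S : Submodule ℂ C₀(X, ℂ)) (x : X) : NormedDual S :=
  LinearMap.mkContinuous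
    { toFun := fun f : S => (f : C₀(X, ℂ)) x
      map_add' := fun _ _ => rfl
      map_smul' := fun _ _ => rfl } 1
    (fun f => by
      rw [one_mul]
      exact (f : C₀(X, ℂ)).toBCF.norm_coe_le_norm x)

/-- The Choquet boundary of a subspace `S` of `C₀(X)`: the points `x` for which `e_x` is an
extreme point of the closed unit ball of the dual of `S`. -/
def choquetBoundary (S : Submodule ℂ C₀(X, ℂ)) : Set X :=
  {x | evalFunctional S x ∈ Set.extremePoints ℝ (Metric.closedBall (0 : NormedDual S) 1)}

/-- The set `δ(A)` of strong boundary points of a subset `A` of `C₀(X)`. -/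
def strongBoundary (A : Set C₀(X, ℂ)) : Set X :=
  {x | ∀ ε : ℝ, 0 < ε → ∀ V ∈ nhds x,
    ∃ f ∈ A, f x = 1 ∧ ‖f‖ = 1 ∧ ∀ z, z ∉ V → ‖f z‖ < ε}

/-- `|A| = {|f| : f ∈ A}`. -/
def modulusSet (A : Set C₀(X, ℂ)) : Set (X → ℝ) :=
  (fun f x => ‖f x‖) '' A

/-- `M(f)`: the set of points at which `f` attains its norm in modulus. -/
def maxSet (f : C₀(X, ℂ)) : Set X :=
  {x | ‖f x‖ = ‖f‖}

/-- `r F_x(A)`: the elements of `A` with `|f(x)| = r = ‖f‖` (this is the dilation by `r > 0` of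
`F_x(A) = {f ∈ A : |f(x)| = 1 = ‖f‖}` when `A` is closed under positive scalars). -/
def normAtSet (A : Set C₀(X, ℂ)) (x : X) (r : ℝ) : Set C₀(X, ℂ) :=
  {f | f ∈ A ∧ ‖f x‖ = r ∧ ‖f‖ = r}

/-- A multiplicative subset of `C₀(X)`. -/
def IsMultiplicative (A : Set C₀(X, ℂ)) : Prop :=
  ∀ f ∈ A, ∀ g ∈ A, f * g ∈ A

/-- The positive part `A₊` of a subset `A` of `C₀(X)`. -/
def positivePart (A : Set C₀(X, ℂ)) : Set C₀(X, ℂ) :=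
  {f | f ∈ A ∧ ∀ x, 0 ≤ (f x).re ∧ (f x).im = 0}

/-- Sets that are either multiplicative or the positive part of a multiplicative set, and that
are closed under multiplication by strictly positive scalars. -/
structure IsAdmissible (A : Set C₀(X, ℂ)) : Prop where
  mult_or_pos : IsMultiplicative A ∨ ∃ M, IsMultiplicative M ∧ A = positivePart M
  smul_mem : ∀ c : ℝ, 0 < c → ∀ f ∈ A, (c : ℂ) • f ∈ A

end Boundaries

section Induced

variable {X Y : Type*} [TopologicalSpace X] [TopologicalSpace Y]

/-- `I^r_y`: the common points of the sets `M(f)`, for `f ∈ A` with `T f ∈ r F_y(B)`. -/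
def setI {A : Set C₀(X, ℂ)} {B : Set C₀(Y, ℂ)} (T : A → B) (y : Y) (r : ℝ) : Set X :=
  {x | ∀ f : A, (T f : C₀(Y, ℂ)) ∈ normAtSet B y r → x ∈ maxSet (f : C₀(X, ℂ))}

/-- `J^r_x`: the common points of the sets `M(T f)`, for `f ∈ r F_x(A)`. -/
def setJ {A : Set C₀(X, ℂ)} {B : Set C₀(Y, ℂ)} (T : A → B) (x : X) (r : ℝ) : Set Y :=
  {y | ∀ f : A, (f : C₀(X, ℂ)) ∈ normAtSet A x r → y ∈ maxSet (T f : C₀(Y, ℂ))}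

/-- `T` induces the map `Φ : Q → P` (with `P ⊆ X`, `Q ⊆ Y`): for every `y ∈ Q` and `r > 0`, the
point `Φ y` is the unique point of `I^r_y` in `P`, and `y` is the unique point of `J^r_{Φ y}`
in `Q`. -/
structure Induces {A : Set C₀(X, ℂ)} {B : Set C₀(Y, ℂ)} (T : A → B)
    {P : Set X} {Q : Set Y} (Φ : Q → P) : Prop where
  inter_I : ∀ (y : Q) (r : ℝ), 0 < r → setI T (y : Y) r ∩ P = {(Φ y : X)}
  inter_J : ∀ (y : Q) (r : ℝ), 0 < r → setJ T (Φ y : X) r ∩ Q = {(y : Y)}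

end Induced

end NormPreserving

/-! By (inc), if two functions reach large moduli at one common point while another pair is never
simultaneously near such values, then `ρ` of the first pair is strictly larger. Testing against
functions that peak at a boundary point therefore locates where moduli are large, and
`ρ`-preservation carries this information through `T`.

Testing `f` against itself gives `‖T f‖ = ‖f‖`. Fix `y` in the Choquet boundary of `ℬ` and `r > 0`.
If `T f₁` and `T f₂` have modulus `r` at `y` and norm `r`, so does their product divided by `r`,
which both of them dominate. By `mem_maxSet_of_dominated`, any boundary point where a preimage of
this product attains its norm lies in `M(f₁) ∩ M(f₂)`. So the compact sets `M(f)` have the finite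
intersection property and share a point. Krein-Milman and Milman in the dual ball of `𝒜` move that
point into the Choquet boundary (`exists_mem_choquetBoundary_maxSet`). Peaking functions then give
uniqueness and independence of `r`.

For the moduli, test `f` against a peak at `Φ y`. If `|T f(y)| > |f(Φ y)|`, the images have the
larger `ρ`, provided the contribution away from the peak is controlled. For `ρ_max` the two orders
of the arguments may be compared crosswise, which suffices; for `ρ₊` each summand is compared with
itself, and (a) or (b) supplies the control.

All this is symmetric in the two sides, so it is carried out for a relation total on both sides; `T`
need not be injective. -/

namespace NormPreserving

/-! ### Milman's theorem in locally convex spaces. -/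

section Milman

variable {E : Type*} [AddCommGroup E] [Module ℝ E] [TopologicalSpace E]
  [IsTopologicalAddGroup E] [ContinuousSMul ℝ E]

theorem isCompact_convexJoin {s t : Set E} (hs : IsCompact s) (ht : IsCompact t) :
    IsCompact (convexJoin ℝ s t) := by
  have h : convexJoin ℝ s t =
      (fun p : ℝ × E × E => (1 - p.1) • p.2.1 + p.1 • p.2.2) '' (Set.Icc (0 : ℝ) 1 ×ˢ s ×ˢ t) := by
    ext x
    simp only [mem_convexJoin, segment_eq_image, Set.mem_image, Set.mem_prod, Prod.exists]
    constructor
    · rintro ⟨a, ha, b, hb, θ, hθ, rfl⟩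
      exact ⟨θ, a, b, ⟨hθ, ha, hb⟩, rfl⟩
    · rintro ⟨θ, a, b, ⟨hθ, ha, hb⟩, rfl⟩
      exact ⟨a, ha, b, hb, θ, hθ, rfl⟩
  rw [h]
  exact (isCompact_Icc.prod (hs.prod ht)).image (by fun_prop)

theorem isCompact_convexHull_union {s t : Set E} (hs : IsCompact s) (ht : IsCompact t)
    (hs' : Convex ℝ s) (ht' : Convex ℝ t) : IsCompact (convexHull ℝ (s ∪ t)) := by
  rcases s.eq_empty_or_nonempty with rfl | hsn
  · simpa [ht'.convexHull_eq] using ht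
  rcases t.eq_empty_or_nonempty with rfl | htn
  · simpa [hs'.convexHull_eq] using hs
  rw [hs'.convexHull_union ht' hsn htn]
  exact isCompact_convexJoin hs ht

/-- **Milman's theorem**, the partial converse of the Krein-Milman theorem. -/
theorem extremePoints_closure_convexHull_subset [T2Space E] [LocallyConvexSpace ℝ E] {K : Set E}
    (hK : IsCompact K) (hC : IsCompact (closure (convexHull ℝ K))) :
    (closure (convexHull ℝ K)).extremePoints ℝ ⊆ K := by
  intro L hL
  by_contra hLK
  have hCconv : Convex ℝ (closure (convexHull ℝ K)) := (convex_convexHull ℝ K).closure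
  have key : ∃ D, IsCompact D ∧ Convex ℝ D ∧ K ⊆ D ∧ D ⊆ closure (convexHull ℝ K) ∧ L ∉ D := by
    -- Compactness induction on "covered by a compact convex part of the hull that misses `L`".
    -- Unions work because an extreme point in the hull of `D ∪ D'` must lie in `D` or `D'`; near
    -- `k`, a half-space at the midpoint between `l k` and `l L` excludes `L`.
    refine hK.induction_on (p := fun S => ∃ D, IsCompact D ∧ Convex ℝ D ∧ S ⊆ D ∧
      D ⊆ closure (convexHull ℝ K) ∧ L ∉ D) ?_ ?_ ?_ ?_
    · exact ⟨∅, isCompact_empty, convex_empty, subset_rfl, Set.empty_subset _, by simp⟩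
    · rintro s t hst ⟨D, h1, h2, h3, h4⟩
      exact ⟨D, h1, h2, hst.trans h3, h4⟩
    · rintro s t ⟨D, h1, h2, h3, h4, h5⟩ ⟨D', h1', h2', h3', h4', h5'⟩
      have hsub : convexHull ℝ (D ∪ D') ⊆ closure (convexHull ℝ K) :=
        convexHull_min (Set.union_subset h4 h4') hCconv
      refine ⟨_, isCompact_convexHull_union h1 h1' h2 h2', convex_convexHull ℝ _,
        (Set.union_subset_union h3 h3').trans (subset_convexHull ℝ _), hsub, fun hLD => ?_⟩
      rcases extremePoints_convexHull_subset
        (inter_extremePoints_subset_extremePoints_of_subset hsub ⟨hLD, hL⟩) with h | h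
      exacts [h5 h, h5' h]
    · intro k hk
      obtain ⟨l, hl⟩ := geometric_hahn_banach_point_point (x := k) (y := L)
        (fun h => hLK (h ▸ hk))
      have hmem : k ∈ {z | l z < (l k + l L) / 2} := by
        simp only [Set.mem_ofPred_eq]
        linarith
      refine ⟨K ∩ {z | l z < (l k + l L) / 2}, inter_mem_nhdsWithin _
          ((isOpen_lt l.continuous continuous_const).mem_nhds hmem),
        closure (convexHull ℝ K) ∩ {z | l z ≤ (l k + l L) / 2}, ?_⟩
      refine ⟨hC.inter_right (isClosed_le l.continuous continuous_const),
        hCconv.inter (convex_halfSpace_le l.toLinearMap.isLinear _), ?_, Set.inter_subset_left, ?_⟩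
      · rintro z ⟨hzK, hz⟩
        exact ⟨subset_closure (subset_convexHull ℝ K hzK), le_of_lt (b := (l k + l L) / 2) hz⟩
      · rintro ⟨-, h⟩
        simp only [Set.mem_ofPred_eq] at h
        linarith
  obtain ⟨D, h1, h2, h3, h4, h5⟩ := key
  exact h5 (closure_minimal (convexHull_min h3 h2) h1.isClosed hL.1)

end Milman

/-! ### Extreme points of the dual ball and norming families. -/

section DualBall

variable {E : Type*} [NormedAddCommGroup E] [NormedSpace ℂ E]

/-- The dual of `E` with the weak-* topology, carrying only the instances needed to apply the
Hahn-Banach and Milman theorems. -/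
def WeakStarDual (E : Type*) [NormedAddCommGroup E] [NormedSpace ℂ E] : Type _ := WeakDual ℂ E

namespace WeakStarDual

noncomputable instance : AddCommGroup (WeakStarDual E) :=
  inferInstanceAs (AddCommGroup (WeakDual ℂ E))

noncomputable instance : Module ℂ (WeakStarDual E) :=
  inferInstanceAs (Module ℂ (WeakDual ℂ E))

noncomputable instance : Module ℝ (WeakStarDual E) := Module.complexToReal _

noncomputable instance : TopologicalSpace (WeakStarDual E) :=
  inferInstanceAs (TopologicalSpace (WeakDual ℂ E))

instance : IsTopologicalAddGroup (WeakStarDual E) :=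
  inferInstanceAs (IsTopologicalAddGroup (WeakDual ℂ E))

instance : ContinuousSMul ℂ (WeakStarDual E) :=
  inferInstanceAs (ContinuousSMul ℂ (WeakDual ℂ E))

instance : ContinuousSMul ℝ (WeakStarDual E) := IsScalarTower.continuousSMul ℂ

instance : T2Space (WeakStarDual E) := inferInstanceAs (T2Space (WeakDual ℂ E))

instance : LocallyConvexSpace ℝ (WeakStarDual E) :=
  (LinearMap.weakBilin_withSeminorms (topDualPairing ℂ E)).toLocallyConvexSpace

/-- The identity map onto the strong dual. -/
noncomputable def toDual : WeakStarDual E ≃ₗ[ℂ] StrongDual ℂ E := WeakDual.toStrongDual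

theorem continuous_toDual_apply (f : E) : Continuous fun M : WeakStarDual E => toDual M f :=
  WeakDual.eval_continuous (𝕜 := ℂ) f

theorem continuous_toDual_symm {Z : Type*} [TopologicalSpace Z] {e : Z → StrongDual ℂ E}
    (he : ∀ f : E, Continuous fun z => e z f) : Continuous fun z => toDual.symm (e z) :=
  WeakDual.continuous_of_continuous_eval (𝕜 := ℂ) he

theorem toDual_smul (a : ℝ) (M : WeakStarDual E) : toDual (a • M) = a • toDual M := by
  rw [← Complex.coe_smul, map_smul]
  ext f
  simp

/-- Hahn-Banach for the weak-* topology, whose continuous functionals are exactly the evaluations at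
elements of `E`. -/
theorem exists_re_apply_lt_of_notMem {s : Set (WeakStarDual E)} (hs : Convex ℝ s)
    (hs' : IsClosed s) {M : WeakStarDual E} (hM : M ∉ s) :
    ∃ (f : E) (u : ℝ), (∀ N ∈ s, (toDual N f).re < u) ∧ u < (toDual M f).re := by
  obtain ⟨l, u, hlu, hul⟩ := RCLike.geometric_hahn_banach_closed_point (𝕜 := ℂ) hs hs' hM
  obtain ⟨f, rfl⟩ := LinearMap.dualEmbedding_surjective (topDualPairing ℂ E) l
  exact ⟨f, u, hlu, hul⟩

variable (E) in
/-- The unit ball of the dual of `E`. -/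
def unitBall : Set (WeakStarDual E) := {M | ‖toDual M‖ ≤ 1}

theorem isCompact_unitBall : IsCompact (unitBall E) := by
  have h : IsCompact (WeakDual.toStrongDual ⁻¹' Metric.closedBall (0 : StrongDual ℂ E) 1) :=
    WeakDual.isCompact_closedBall 0 1
  have h' : unitBall E = WeakDual.toStrongDual ⁻¹' Metric.closedBall (0 : StrongDual ℂ E) 1 :=
    Set.ext fun M => mem_closedBall_zero_iff.symm
  rw [h']
  exact h

theorem mem_unitBall {M : WeakStarDual E} : M ∈ unitBall E ↔ ‖toDual M‖ ≤ 1 := Iff.rfl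

theorem convex_unitBall : Convex ℝ (unitBall E) := by
  intro M hM N hN a b ha hb hab
  rw [mem_unitBall, ← mem_closedBall_zero_iff] at hM hN ⊢
  rw [map_add, toDual_smul, toDual_smul]
  exact convex_closedBall (0 : StrongDual ℂ E) 1 hM hN ha hb hab

theorem norm_toDual_apply_le {M : WeakStarDual E} (hM : M ∈ unitBall E) (f : E) :
    ‖toDual M f‖ ≤ ‖f‖ :=
  ((toDual M).le_opNorm f).trans (mul_le_of_le_one_left (norm_nonneg _) hM)

theorem mem_extremePoints_unitBall {M : WeakStarDual E} :
    M ∈ (unitBall E).extremePoints ℝ ↔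
      toDual M ∈ (Metric.closedBall (0 : StrongDual ℂ E) 1).extremePoints ℝ := by
  simp only [mem_extremePoints_iff_left, mem_unitBall, mem_closedBall_zero_iff]
  refine and_congr_right fun _ => ⟨fun h N₁ h₁ N₂ h₂ hM => ?_, fun h N₁ h₁ N₂ h₂ hM => ?_⟩
  · obtain ⟨a, b, ha, hb, hab, hM⟩ := hM
    have := h (toDual.symm N₁) (by simpa using h₁) (toDual.symm N₂) (by simpa using h₂)
      ⟨a, b, ha, hb, hab, toDual.injective (by simpa [toDual_smul] using hM)⟩
    rw [← this, LinearEquiv.apply_symm_apply]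
  · obtain ⟨a, b, ha, hb, hab, rfl⟩ := hM
    exact toDual.injective (h _ h₁ _ h₂ ⟨a, b, ha, hb, hab, by simp [toDual_smul]⟩)

end WeakStarDual

open WeakStarDual

theorem exists_norm_eq_one_mul_eq_norm (w : ℂ) : ∃ c : ℂ, ‖c‖ = 1 ∧ c * w = ‖w‖ := by
  rcases eq_or_ne w 0 with h | h
  · exact ⟨1, by simp, by simp [h]⟩
  · exact ⟨‖w‖ / w, by simp [h], by field_simp⟩

/-- If a weak-* compact family of functionals in the dual unit ball is norming, then every extreme
point of the dual unit ball is a unimodular multiple of one of them. -/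
theorem exists_eq_smul_of_mem_extremePoints {Z : Type*} [TopologicalSpace Z] [CompactSpace Z]
    (e : Z → StrongDual ℂ E) (he : ∀ f : E, Continuous fun z => e z f) (he₁ : ∀ z, ‖e z‖ ≤ 1)
    (hnorming : ∀ f : E, ∃ z, ‖f‖ ≤ ‖e z f‖) {L : StrongDual ℂ E}
    (hL : L ∈ (Metric.closedBall (0 : StrongDual ℂ E) 1).extremePoints ℝ) :
    ∃ z, ∃ c : ℂ, ‖c‖ = 1 ∧ L = c • e z := by
  let K : Set (WeakStarDual E) := (fun p : ℂ × Z => toDual.symm (p.1 • e p.2)) ''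
    (Metric.sphere (0 : ℂ) 1 ×ˢ Set.univ)
  have hKcomp : IsCompact K :=
    ((isCompact_sphere _ _).prod isCompact_univ).image (continuous_toDual_symm
      (e := fun p : ℂ × Z => p.1 • e p.2) fun f => continuous_fst.mul ((he f).comp continuous_snd))
  have hKC : K ⊆ unitBall E := by
    rintro _ ⟨⟨c, z⟩, ⟨hc, -⟩, rfl⟩
    simp only [mem_sphere_zero_iff_norm] at hc
    simpa [mem_unitBall, norm_smul, hc] using he₁ z
  -- A point of the ball outside the hull would be separated from it by some `f`. A unimodular
  -- multiple of a norming `e z` takes at `f` a real value at least `‖f‖`, so no such separation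
  -- exists.
  have hclosure : closure (convexHull ℝ K) = unitBall E := by
    refine (closure_minimal (convexHull_min hKC convex_unitBall)
      isCompact_unitBall.isClosed).antisymm fun M hM => ?_
    by_contra hMK
    obtain ⟨f, u, hlu, hul⟩ := exists_re_apply_lt_of_notMem (convex_convexHull ℝ K).closure
      isClosed_closure hMK
    have hM' : (toDual M f).re ≤ ‖f‖ := (Complex.re_le_norm _).trans (norm_toDual_apply_le hM f)
    obtain ⟨z, hz⟩ := hnorming f
    obtain ⟨c, hc, hcz⟩ := exists_norm_eq_one_mul_eq_norm (e z f)
    have h3 := hlu (toDual.symm (c • e z))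
      (subset_closure (subset_convexHull ℝ K ⟨(c, z), ⟨by simpa using hc, trivial⟩, rfl⟩))
    rw [LinearEquiv.apply_symm_apply, smul_apply, smul_eq_mul, hcz, Complex.ofReal_re] at h3
    linarith
  have hLC : toDual.symm L ∈ (unitBall E).extremePoints ℝ :=
    mem_extremePoints_unitBall.2 (by rwa [LinearEquiv.apply_symm_apply])
  rw [← hclosure] at hLC
  obtain ⟨⟨c, z⟩, ⟨hc, -⟩, hcz⟩ := extremePoints_closure_convexHull_subset hKcomp
    (hclosure ▸ isCompact_unitBall) hLC
  exact ⟨z, c, by simpa using hc, (toDual.symm.injective hcz).symm⟩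

/-- If a functional in the dual unit ball attains its norm at all elements of `H`, then so does
some extreme point of the ball. -/
theorem exists_mem_extremePoints_norm_eq (H : Set E) {L₀ : StrongDual ℂ E} (hL₀ : ‖L₀‖ ≤ 1)
    (hH : ∀ h ∈ H, ‖L₀ h‖ = ‖h‖) :
    ∃ L ∈ (Metric.closedBall (0 : StrongDual ℂ E) 1).extremePoints ℝ, ∀ h ∈ H, ‖L h‖ = ‖h‖ := by
  set F : Set (WeakStarDual E) := {M | ∀ h ∈ H, toDual M h = L₀ h} with hF
  have hFclosed : IsClosed F := by
    simp only [hF, Set.ofPred_forall]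
    exact isClosed_biInter fun h _ => isClosed_eq (continuous_toDual_apply h) continuous_const
  have hne : (unitBall E ∩ F).Nonempty :=
    ⟨toDual.symm L₀, by simpa [mem_unitBall] using hL₀, fun h _ => by simp⟩
  obtain ⟨L, hL⟩ := (isCompact_unitBall.inter_right hFclosed).extremePoints_nonempty hne
  -- The functionals agreeing with `L₀` on `H` form a face: by strict convexity of `ℂ`, `L₀ h` is an
  -- extreme point of the disc of radius `‖h‖`, which contains the values at `h` of all functionals
  -- in the ball.
  have hext : IsExtreme ℝ (unitBall E) (unitBall E ∩ F) := by
    refine ⟨Set.inter_subset_left, ?_⟩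
    rintro M hM N hN P ⟨hP, hPF⟩ ⟨a, b, ha, hb, hab, rfl⟩
    refine ⟨hM, fun h hh => ?_⟩
    rcases eq_or_ne h 0 with rfl | h0
    · exact (map_zero _).trans (map_zero L₀).symm
    have hs : L₀ h ∈ (Metric.closedBall (0 : ℂ) ‖h‖).extremePoints ℝ :=
      StrictConvexSpace.sphere_subset_extremePoints_closedBall (0 : ℂ) (norm_ne_zero_iff.2 h0)
        (mem_sphere_zero_iff_norm.2 (hH h hh))
    have h5 : a • toDual M h + b • toDual N h = L₀ h := by
      rw [← hPF h hh, map_add, WeakStarDual.toDual_smul, WeakStarDual.toDual_smul]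
      rfl
    exact hs.2 (by simpa using norm_toDual_apply_le hM h)
      (by simpa using norm_toDual_apply_le hN h) ⟨a, b, ha, hb, hab, h5⟩
  refine ⟨toDual L, mem_extremePoints_unitBall.1 (hext.extremePoints_subset_extremePoints hL),
    fun h hh => ?_⟩
  rw [← hH h hh, hL.1.2 h hh]

/-- If some functional in the unit ball attains its norm at all the elements of `H`, then so does
some element of a given norming weak-* compact family that is an extreme point of the ball. -/
theorem exists_mem_norming_family {Z : Type*} [TopologicalSpace Z] [CompactSpace Z]
    (e : Z → StrongDual ℂ E) (he : ∀ f : E, Continuous fun z => e z f) (he₁ : ∀ z, ‖e z‖ ≤ 1)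
    (hnorming : ∀ f : E, ∃ z, ‖f‖ ≤ ‖e z f‖) (H : Set E) {L₀ : StrongDual ℂ E}
    (hL₀ : ‖L₀‖ ≤ 1) (hH : ∀ h ∈ H, ‖L₀ h‖ = ‖h‖) :
    ∃ z, e z ∈ (Metric.closedBall (0 : StrongDual ℂ E) 1).extremePoints ℝ ∧
      ∀ h ∈ H, ‖e z h‖ = ‖h‖ := by
  obtain ⟨M, hM, hMH⟩ := exists_mem_extremePoints_norm_eq H hL₀ hH
  obtain ⟨z, c, hc, rfl⟩ := exists_eq_smul_of_mem_extremePoints e he he₁ hnorming hM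
  refine ⟨z, ⟨by simpa using he₁ z, ?_⟩, fun h hh => ?_⟩
  · have hc0 : c ≠ 0 := by
      rintro rfl
      simp at hc
    rintro M hM' N hN ⟨a, b, ha, hb, hab, h⟩
    have h1 : c • M = c • e z := by
      refine hM.2 (x₁ := c • M) (x₂ := c • N) ?_ ?_ ⟨a, b, ha, hb, hab, ?_⟩
      · simpa [norm_smul, hc] using hM'
      · simpa [norm_smul, hc] using hN
      · rw [← h, smul_add, smul_comm a c, smul_comm b c]
    exact smul_right_injective _ hc0 h1
  · have := hMH h hh
    rwa [smul_apply, norm_smul, hc, one_mul] at this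

theorem exists_norm_le_one_norm_apply_eq (f : E) :
    ∃ L : StrongDual ℂ E, ‖L‖ ≤ 1 ∧ ‖L f‖ = ‖f‖ := by
  obtain ⟨L, hL, hLf⟩ := exists_dual_vector'' ℂ f
  exact ⟨L, hL, by simp [hLf]⟩

end DualBall

/-! ### Common maximum points in the Choquet boundary. -/

section Functionals

variable {X : Type*} [TopologicalSpace X] (S : Submodule ℂ C₀(X, ℂ))

theorem norm_apply_le (f : C₀(X, ℂ)) (x : X) : ‖f x‖ ≤ ‖f‖ := f.toBCF.norm_coe_le_norm x

theorem norm_le_of_forall {f : C₀(X, ℂ)} {c : ℝ} (hc : 0 ≤ c) (h : ∀ x, ‖f x‖ ≤ c) : ‖f‖ ≤ c :=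
  (BoundedContinuousFunction.norm_le (f := f.toBCF) hc).2 h

theorem norm_evalFunctional_le (x : X) : ‖evalFunctional S x‖ ≤ 1 :=
  LinearMap.mkContinuous_norm_le _ zero_le_one _

/-- The evaluation functionals, extended by zero at infinity. -/
noncomputable def evalOnePoint (z : OnePoint X) : NormedDual S :=
  z.elim 0 (evalFunctional S)

theorem continuous_evalOnePoint_apply [T2Space X] (f : S) :
    Continuous fun z => evalOnePoint S z f := by
  rw [OnePoint.continuous_iff]
  refine ⟨?_, (f : C₀(X, ℂ)).continuous⟩
  rw [Filter.coclosedCompact_eq_cocompact]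
  exact (f : C₀(X, ℂ)).zero_at_infty'

theorem norm_evalOnePoint_le (z : OnePoint X) : ‖evalOnePoint S z‖ ≤ 1 := by
  induction z using OnePoint.rec with
  | infty => simp [evalOnePoint]
  | coe x => exact norm_evalFunctional_le S x

theorem exists_norm_le_evalOnePoint [T2Space X] (f : S) : ∃ z, ‖f‖ ≤ ‖evalOnePoint S z f‖ := by
  obtain ⟨z, -, hz⟩ := isCompact_univ.exists_isMaxOn Set.univ_nonempty
    (continuous_evalOnePoint_apply S f).norm.continuousOn
  exact ⟨z, norm_le_of_forall (norm_nonneg _) fun x => hz (Set.mem_univ (x : OnePoint X))⟩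

/-- If a functional in the unit ball attains its norm at all the elements of `H`, then these
functions have a common maximum modulus point in the Choquet boundary. -/
theorem exists_mem_choquetBoundary_maxSet [T2Space X] (H : Set S) {f₀ : S} (hf₀ : f₀ ∈ H)
    (hf₀0 : ‖f₀‖ ≠ 0) {L : NormedDual S} (hL : ‖L‖ ≤ 1) (hH : ∀ h ∈ H, ‖L h‖ = ‖h‖) :
    ∃ x ∈ choquetBoundary S, ∀ h ∈ H, x ∈ maxSet (h : C₀(X, ℂ)) := by
  obtain ⟨z, hz, hzH⟩ := exists_mem_norming_family (evalOnePoint S)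
    (continuous_evalOnePoint_apply S) (norm_evalOnePoint_le S) (exists_norm_le_evalOnePoint S)
    H hL hH
  induction z using OnePoint.rec with
  -- The functional at infinity is zero, so it cannot attain the nonzero norm of `f₀`.
  | infty => exact absurd ((hzH f₀ hf₀).symm.trans norm_zero) hf₀0
  | coe x => exact ⟨x, hz, hzH⟩

theorem exists_normedDual_norm_apply_eq (f : S) : ∃ L : NormedDual S, ‖L‖ ≤ 1 ∧ ‖L f‖ = ‖f‖ :=
  exists_norm_le_one_norm_apply_eq f

theorem norm_eq_of_norm_apply_eq {f g : C₀(X, ℂ)} (h : ∀ x, ‖f x‖ = ‖g x‖) : ‖f‖ = ‖g‖ :=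
  le_antisymm (norm_le_of_forall (norm_nonneg _) fun x => h x ▸ norm_apply_le g x)
    (norm_le_of_forall (norm_nonneg _) fun x => h x ▸ norm_apply_le f x)

variable {S} in
theorem exists_norm_apply_eq_of_modulusSet_subset {A : Set C₀(X, ℂ)}
    (hA : modulusSet A ⊆ modulusSet (S : Set C₀(X, ℂ))) {g : C₀(X, ℂ)} (hg : g ∈ A) :
    ∃ h : S, ∀ x, ‖(h : C₀(X, ℂ)) x‖ = ‖g x‖ := by
  obtain ⟨h, hh, hgh⟩ := hA ⟨g, hg, rfl⟩
  exact ⟨⟨h, hh⟩, fun x => congrFun hgh x⟩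

variable {S} in
theorem exists_mem_choquetBoundary_maxSet_of_modulusSet_subset [T2Space X] {A : Set C₀(X, ℂ)}
    (hA : modulusSet A ⊆ modulusSet (S : Set C₀(X, ℂ))) {f : C₀(X, ℂ)} (hf : f ∈ A)
    (hf0 : ‖f‖ ≠ 0) : ∃ x ∈ choquetBoundary S, x ∈ maxSet f := by
  obtain ⟨h, hh⟩ := exists_norm_apply_eq_of_modulusSet_subset hA hf
  have hn : ‖h‖ = ‖f‖ := norm_eq_of_norm_apply_eq hh
  obtain ⟨L, hL, hLh⟩ := exists_normedDual_norm_apply_eq S h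
  obtain ⟨x, hx, hxH⟩ := exists_mem_choquetBoundary_maxSet S {h} (Set.mem_singleton _)
    (hn ▸ hf0) hL (fun k hk => Set.mem_singleton_iff.1 hk ▸ hLh)
  have h1 : ‖(h : C₀(X, ℂ)) x‖ = ‖h‖ := hxH h (Set.mem_singleton _)
  exact ⟨x, hx, (hh x).symm.trans (h1.trans hn)⟩

variable {S} in
theorem exists_mem_choquetBoundary_of_common_maxSet [T2Space X] {A : Set C₀(X, ℂ)}
    (hA : modulusSet A ⊆ modulusSet (S : Set C₀(X, ℂ))) {H : Set C₀(X, ℂ)} (hHA : H ⊆ A)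
    {f : C₀(X, ℂ)} (hf : f ∈ H) (hf0 : ‖f‖ ≠ 0) {x₀ : X} (hx₀ : ∀ h ∈ H, x₀ ∈ maxSet h) :
    ∃ x ∈ choquetBoundary S, ∀ h ∈ H, x ∈ maxSet h := by
  obtain ⟨h₀, hh₀⟩ := exists_norm_apply_eq_of_modulusSet_subset hA (hHA hf)
  -- `H` need not lie in `S`, so it is replaced by all elements of `S` sharing their modulus with a
  -- member of `H`; evaluation at `x₀` is norm attaining on each of them.
  obtain ⟨x, hx, hxG⟩ := exists_mem_choquetBoundary_maxSet S
    {h | ∃ g ∈ H, ∀ x, ‖(h : C₀(X, ℂ)) x‖ = ‖g x‖} (f₀ := h₀) ⟨f, hf, hh₀⟩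
    (fun h0 => hf0 ((norm_eq_of_norm_apply_eq hh₀).symm.trans h0))
    (norm_evalFunctional_le S x₀) (by
      rintro h ⟨g, hg, hgh⟩
      exact (hgh x₀).trans ((hx₀ g hg : ‖g x₀‖ = ‖g‖).trans (norm_eq_of_norm_apply_eq hgh).symm))
  refine ⟨x, hx, fun g hg => ?_⟩
  obtain ⟨h, hh⟩ := exists_norm_apply_eq_of_modulusSet_subset hA (hHA hg)
  exact (hh x).symm.trans ((hxG h ⟨g, hg, hh⟩).trans (norm_eq_of_norm_apply_eq hh))

end Functionals

/-! ### Comparing values of `ρ` through moduli. -/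

section RhoEstimates

/-- The restriction of `φ` to pairs of real numbers. -/
noncomputable def onReal (φ : C(ℂ × ℂ, ℝ)) (a b : ℝ) : ℝ := φ ((a : ℂ), (b : ℂ))

variable {φ : C(ℂ × ℂ, ℝ)}

theorem continuous_onReal : Continuous fun p : ℝ × ℝ => onReal φ p.1 p.2 := by
  unfold onReal
  fun_prop

namespace IsInc

theorem apply_le_onReal (hφ : IsInc φ) {s t : ℂ} {a b : ℝ} (hs : ‖s‖ ≤ a) (ht : ‖t‖ ≤ b) :
    φ (s, t) ≤ onReal φ a b := by
  have ha : 0 ≤ a := (norm_nonneg s).trans hs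
  have hb : 0 ≤ b := (norm_nonneg t).trans ht
  exact (hφ.le_left s a t (by simpa [abs_of_nonneg ha] using hs)).trans
    (hφ.le_right t b a (by simpa [abs_of_nonneg hb] using ht))

theorem onReal_norm_le (hφ : IsInc φ) (s t : ℂ) : onReal φ ‖s‖ ‖t‖ ≤ φ (s, t) :=
  (hφ.le_left _ s _ (by simp)).trans (hφ.le_right _ t _ (by simp))

theorem onReal_lt_left (hφ : IsInc φ) {a a' b b' : ℝ} (ha : 0 ≤ a) (haa : a < a') (hb : 0 ≤ b)
    (hbb : b ≤ b') (hb' : 0 < b') : onReal φ a b < onReal φ a' b' := by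
  refine (hφ.le_right b b' a ?_).trans_lt (hφ.lt_left a a' b' (by exact_mod_cast hb'.ne') ?_)
  · simpa [abs_of_nonneg hb, abs_of_pos hb'] using hbb
  · simpa [abs_of_nonneg ha, abs_of_pos (ha.trans_lt haa)] using haa

theorem onReal_lt_right (hφ : IsInc φ) {a a' b b' : ℝ} (ha : 0 ≤ a) (haa : a ≤ a') (ha' : 0 < a')
    (hb : 0 ≤ b) (hbb : b < b') : onReal φ a b < onReal φ a' b' := by
  refine (hφ.le_left a a' b ?_).trans_lt (hφ.lt_right b b' a' (by exact_mod_cast ha'.ne') ?_)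
  · simpa [abs_of_nonneg ha, abs_of_pos ha'] using haa
  · simpa [abs_of_nonneg hb, abs_of_pos (hb.trans_lt hbb)] using hbb

end IsInc

variable {X Y : Type*} [TopologicalSpace X] [TopologicalSpace Y]

@[simp]
theorem comp₂_apply (f g : X →ᵇ ℂ) (x : X) : comp₂ φ f g x = φ (f x, g x) := rfl

theorem onReal_le_norm_comp₂ (hφ : IsInc φ) (f g : X →ᵇ ℂ) (x : X) :
    onReal φ ‖f x‖ ‖g x‖ ≤ ‖comp₂ φ f g‖ :=
  (hφ.onReal_norm_le _ _).trans ((le_abs_self _).trans ((comp₂ φ f g).norm_coe_le_norm x))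

theorem norm_comp₂_le (hφ0 : ∀ p, 0 ≤ φ p) {f g : X →ᵇ ℂ} {c : ℝ} (hc : 0 ≤ c)
    (h : ∀ x, φ (f x, g x) ≤ c) : ‖comp₂ φ f g‖ ≤ c :=
  (BoundedContinuousFunction.norm_le hc).2 fun x => by
    rw [comp₂_apply, Real.norm_of_nonneg (hφ0 _)]
    exact h x

theorem rho_mono (hφ0 : ∀ p, 0 ≤ φ p) (hφ : IsInc φ) (k : RhoKind) {f f' : X →ᵇ ℂ} (g : X →ᵇ ℂ)
    (h : ∀ x, ‖f x‖ ≤ ‖f' x‖) : rho k φ f g ≤ rho k φ f' g := by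
  have h₁ : ‖comp₂ φ f g‖ ≤ ‖comp₂ φ f' g‖ := norm_comp₂_le hφ0 (norm_nonneg _) fun x =>
    (hφ.apply_le_onReal (h x) le_rfl).trans (onReal_le_norm_comp₂ hφ f' g x)
  have h₂ : ‖comp₂ φ g f‖ ≤ ‖comp₂ φ g f'‖ := norm_comp₂_le hφ0 (norm_nonneg _) fun x =>
    (hφ.apply_le_onReal le_rfl (h x)).trans (onReal_le_norm_comp₂ hφ g f' x)
  cases k with
  | plus => exact add_le_add h₁ h₂
  | max => exact max_le_max h₁ h₂

theorem norm_comp₂_le_max (hφ0 : ∀ p, 0 ≤ φ p) (hφ : IsInc φ) {f g : X →ᵇ ℂ} {a b a' b' : ℝ}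
    (h : ∀ x, (‖f x‖ ≤ a ∧ ‖g x‖ ≤ b) ∨ (‖f x‖ ≤ a' ∧ ‖g x‖ ≤ b')) :
    ‖comp₂ φ f g‖ ≤ max (onReal φ a b) (onReal φ a' b') := by
  refine norm_comp₂_le hφ0 (le_max_of_le_left (hφ0 _)) fun x => ?_
  rcases h x with ⟨h₁, h₂⟩ | ⟨h₁, h₂⟩
  · exact le_max_of_le_left (hφ.apply_le_onReal h₁ h₂)
  · exact le_max_of_le_right (hφ.apply_le_onReal h₁ h₂)

/-- The tool behind the contradiction arguments: two regions bound the first pair everywhere, and a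
single point bounds the second pair from below. Each order of the arguments is compared with itself,
so it serves both kinds of `ρ`. -/
theorem rho_lt (hφ0 : ∀ p, 0 ≤ φ p) (hφ : IsInc φ) (k : RhoKind) {f g : X →ᵇ ℂ} {a b a' b' : ℝ}
    (h : ∀ x, (‖f x‖ ≤ a ∧ ‖g x‖ ≤ b) ∨ (‖f x‖ ≤ a' ∧ ‖g x‖ ≤ b'))
    {f' g' : Y →ᵇ ℂ} {y : Y} {s t : ℝ} (hs : ‖f' y‖ = s) (ht : ‖g' y‖ = t)
    (h₁ : onReal φ a b < onReal φ s t) (h₂ : onReal φ a' b' < onReal φ s t)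
    (h₃ : onReal φ b a < onReal φ t s) (h₄ : onReal φ b' a' < onReal φ t s) :
    rho k φ f g < rho k φ f' g' := by
  have e₁ : ‖comp₂ φ f g‖ < ‖comp₂ φ f' g'‖ :=
    ((norm_comp₂_le_max hφ0 hφ h).trans_lt (max_lt h₁ h₂)).trans_le
      (hs ▸ ht ▸ onReal_le_norm_comp₂ hφ f' g' y)
  have e₂ : ‖comp₂ φ g f‖ < ‖comp₂ φ g' f'‖ :=
    ((norm_comp₂_le_max hφ0 hφ fun x => (h x).imp And.symm And.symm).trans_lt
      (max_lt h₃ h₄)).trans_le (hs ▸ ht ▸ onReal_le_norm_comp₂ hφ g' f' y)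
  cases k with
  | plus => exact add_lt_add e₁ e₂
  | max => exact max_lt_max e₁ e₂

/-- For a maximum it is enough to beat each bound in either order; on the second region the orders
are compared crosswise. -/
theorem rhoMax_lt (hφ0 : ∀ p, 0 ≤ φ p) (hφ : IsInc φ) {f g : X →ᵇ ℂ} {a b a' b' : ℝ}
    (h : ∀ x, (‖f x‖ ≤ a ∧ ‖g x‖ ≤ b) ∨ (‖f x‖ ≤ a' ∧ ‖g x‖ ≤ b'))
    {f' g' : Y →ᵇ ℂ} {y : Y} {s t : ℝ} (hs : ‖f' y‖ = s) (ht : ‖g' y‖ = t)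
    (h₁ : onReal φ a b < onReal φ s t) (h₂ : onReal φ a' b' < onReal φ t s)
    (h₃ : onReal φ b a < onReal φ t s) (h₄ : onReal φ b' a' < onReal φ s t) :
    rhoMax φ f g < rhoMax φ f' g' := by
  have e₁ := norm_comp₂_le_max hφ0 hφ h
  have e₂ := norm_comp₂_le_max hφ0 hφ fun x => (h x).imp And.symm And.symm
  have d₁ : onReal φ s t ≤ ‖comp₂ φ f' g'‖ := hs ▸ ht ▸ onReal_le_norm_comp₂ hφ f' g' y
  have d₂ : onReal φ t s ≤ ‖comp₂ φ g' f'‖ := hs ▸ ht ▸ onReal_le_norm_comp₂ hφ g' f' y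
  refine max_lt (e₁.trans_lt (max_lt ?_ ?_)) (e₂.trans_lt (max_lt ?_ ?_))
  · exact lt_max_of_lt_left (h₁.trans_le d₁)
  · exact lt_max_of_lt_right (h₂.trans_le d₂)
  · exact lt_max_of_lt_right (h₃.trans_le d₂)
  · exact lt_max_of_lt_left (h₄.trans_le d₁)

end RhoEstimates

/-! ### Peaking functions and maximum sets. -/

section Peaking

variable {X : Type*} [TopologicalSpace X]

/-- The properties of a set `A` of functions and of a set `P` of strong boundary points of `A`
that are used for the construction of the induced bijection. -/
structure IsPeaking (A : Set C₀(X, ℂ)) (P : Set X) : Prop where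
  mul_mem : ∀ f ∈ A, ∀ g ∈ A, f * g ∈ A
  smul_mem : ∀ c : ℝ, 0 < c → ∀ f ∈ A, (c : ℂ) • f ∈ A
  peak : ∀ x ∈ P, ∀ r : ℝ, 0 < r → ∀ ε : ℝ, 0 < ε → ∀ V ∈ nhds x,
    ∃ f ∈ normAtSet A x r, ∀ z, z ∉ V → ‖f z‖ < ε
  exists_max : ∀ f ∈ A, ‖f‖ ≠ 0 → ∃ x ∈ P, x ∈ maxSet f
  exists_common_max : ∀ H ⊆ A, (∃ f ∈ H, ‖f‖ ≠ 0) → (∃ x, ∀ f ∈ H, x ∈ maxSet f) →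
    ∃ x ∈ P, ∀ f ∈ H, x ∈ maxSet f

theorem IsAdmissible.mul_mem {A : Set C₀(X, ℂ)} (hA : IsAdmissible A) :
    ∀ f ∈ A, ∀ g ∈ A, f * g ∈ A := by
  rcases hA.mult_or_pos with h | ⟨M, hM, rfl⟩
  · exact h
  · rintro f ⟨hf, hf'⟩ g ⟨hg, hg'⟩
    refine ⟨hM f hf g hg, fun x => ?_⟩
    rw [ZeroAtInftyContinuousMap.mul_apply, Complex.mul_re, Complex.mul_im, (hf' x).2, (hg' x).2]
    simpa using mul_nonneg (hf' x).1 (hg' x).1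

theorem norm_smul_apply (c : ℝ) (hc : 0 < c) (f : C₀(X, ℂ)) (x : X) :
    ‖((c : ℂ) • f) x‖ = c * ‖f x‖ := by
  rw [ZeroAtInftyContinuousMap.smul_apply, norm_smul, Complex.norm_real, Real.norm_of_nonneg hc.le]

theorem norm_ofReal_smul (c : ℝ) (hc : 0 < c) (f : C₀(X, ℂ)) : ‖(c : ℂ) • f‖ = c * ‖f‖ := by
  rw [norm_smul, Complex.norm_real, Real.norm_of_nonneg hc.le]

theorem IsAdmissible.isPeaking [T2Space X] {A : Set C₀(X, ℂ)} (hA : IsAdmissible A)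
    {S : Submodule ℂ C₀(X, ℂ)} (hδ : choquetBoundary S ⊆ strongBoundary A)
    (hAS : modulusSet A ⊆ modulusSet (S : Set C₀(X, ℂ))) : IsPeaking A (choquetBoundary S) where
  mul_mem := hA.mul_mem
  smul_mem := hA.smul_mem
  peak x hx r hr ε hε V hV := by
    obtain ⟨f, hf, hfx, hf1, hfV⟩ := hδ hx (ε / r) (div_pos hε hr) V hV
    refine ⟨(r : ℂ) • f, ⟨hA.smul_mem r hr f hf, ?_, ?_⟩, fun z hz => ?_⟩
    · rw [norm_smul_apply r hr, hfx, norm_one, mul_one]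
    · rw [norm_ofReal_smul r hr, hf1, mul_one]
    · rw [norm_smul_apply r hr, mul_comm]
      exact (lt_div_iff₀ hr).1 (hfV z hz)
  exists_max _ hf hf0 := exists_mem_choquetBoundary_maxSet_of_modulusSet_subset hAS hf hf0
  exists_common_max _ hHA := fun ⟨_, hf, hf0⟩ ⟨_, hx⟩ =>
    exists_mem_choquetBoundary_of_common_maxSet hAS hHA hf hf0 hx

theorem isClosed_maxSet (f : C₀(X, ℂ)) : IsClosed (maxSet f) :=
  isClosed_eq f.continuous.norm continuous_const

theorem isCompact_maxSet {f : C₀(X, ℂ)} (hf : ‖f‖ ≠ 0) : IsCompact (maxSet f) := by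
  have h : ∀ᶠ x in Filter.cocompact X, ‖f x‖ < ‖f‖ := by
    have := f.zero_at_infty'.norm
    rw [norm_zero] at this
    exact this.eventually_lt_const ((norm_nonneg f).lt_of_ne' hf)
  obtain ⟨t, ht, htf⟩ := Filter.mem_cocompact.1 h
  refine ht.of_isClosed_subset (isClosed_maxSet f) fun x hx => ?_
  by_contra hxt
  exact absurd (show ‖f x‖ < ‖f‖ from htf hxt) (show ‖f x‖ = ‖f‖ from hx).not_lt

/-- The witness is `r⁻¹ • (f * g)`: both factors are bounded by `r`, with equality at `x`. -/
theorem IsPeaking.exists_dominated {A : Set C₀(X, ℂ)} {P : Set X} (hA : IsPeaking A P) {x : X}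
    {r : ℝ} (hr : 0 < r) {f g : C₀(X, ℂ)} (hf : f ∈ normAtSet A x r) (hg : g ∈ normAtSet A x r) :
    ∃ h ∈ normAtSet A x r, (∀ z, ‖h z‖ ≤ ‖f z‖) ∧ ∀ z, ‖h z‖ ≤ ‖g z‖ := by
  obtain ⟨hfA, hfx, hfn⟩ := hf
  obtain ⟨hgA, hgx, hgn⟩ := hg
  have hr' : 0 < r⁻¹ := inv_pos.2 hr
  have happ : ∀ z, ‖((r⁻¹ : ℝ) : ℂ) • (f * g) z‖ = r⁻¹ * (‖f z‖ * ‖g z‖) := fun z => by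
    rw [ZeroAtInftyContinuousMap.mul_apply, norm_smul, Complex.norm_real,
      Real.norm_of_nonneg hr'.le, norm_mul]
  have h₁ : ∀ z, ‖((r⁻¹ : ℝ) : ℂ) • (f * g) z‖ ≤ ‖f z‖ := fun z => by
    rw [happ, inv_mul_le_iff₀ hr, mul_comm r]
    exact mul_le_mul_of_nonneg_left (hgn ▸ norm_apply_le g z) (norm_nonneg _)
  have h₂ : ∀ z, ‖((r⁻¹ : ℝ) : ℂ) • (f * g) z‖ ≤ ‖g z‖ := fun z => by
    rw [happ, inv_mul_le_iff₀ hr]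
    exact mul_le_mul_of_nonneg_right (hfn ▸ norm_apply_le f z) (norm_nonneg _)
  have hx : ‖((r⁻¹ : ℝ) : ℂ) • (f * g) x‖ = r := by
    rw [happ, hfx, hgx]
    field_simp
  refine ⟨((r⁻¹ : ℝ) : ℂ) • (f * g), ⟨hA.smul_mem _ hr' _ (hA.mul_mem f hfA g hgA), hx, ?_⟩,
    h₁, h₂⟩
  refine le_antisymm (norm_le_of_forall hr.le fun z => (h₁ z).trans (hfn ▸ norm_apply_le f z)) ?_
  exact hx.symm.trans_le (norm_apply_le (((r⁻¹ : ℝ) : ℂ) • (f * g)) x)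

end Peaking

/-! ### The induced correspondence of boundary points. -/

section Coupling

variable {X Y : Type*} [TopologicalSpace X] [TopologicalSpace Y]

/-- A relation between `A` and `B`, total on both sides, that preserves `ρ`. -/
structure IsCoupling (k : RhoKind) (φ : C(ℂ × ℂ, ℝ)) (A : Set C₀(X, ℂ)) (B : Set C₀(Y, ℂ))
    (R : C₀(X, ℂ) → C₀(Y, ℂ) → Prop) : Prop where
  mem_left : ∀ {f g}, R f g → f ∈ A
  mem_right : ∀ {f g}, R f g → g ∈ B
  total_left : ∀ f ∈ A, ∃ g, R f g
  total_right : ∀ g ∈ B, ∃ f, R f g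
  rho_eq : ∀ {f g f' g'}, R f g → R f' g' →
    rho k φ g.toBCF g'.toBCF = rho k φ f.toBCF f'.toBCF

/-- The common points of the sets `M(f)`, where `f` is related to some `g` with
`|g(y)| = r = ‖g‖`. -/
def commonMax (R : C₀(X, ℂ) → C₀(Y, ℂ) → Prop) (B : Set C₀(Y, ℂ)) (y : Y) (r : ℝ) : Set X :=
  {x | ∀ f g, R f g → g ∈ normAtSet B y r → x ∈ maxSet f}

/-- The points `x ∈ P` and `y ∈ Q` correspond to each other under the relation `R`. -/
structure Matched (R : C₀(X, ℂ) → C₀(Y, ℂ) → Prop) (A : Set C₀(X, ℂ)) (B : Set C₀(Y, ℂ))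
    (P : Set X) (Q : Set Y) (x : X) (y : Y) : Prop where
  left_mem : x ∈ P
  right_mem : y ∈ Q
  mem_left : ∀ r : ℝ, 0 < r → x ∈ commonMax R B y r
  mem_right : ∀ r : ℝ, 0 < r → y ∈ commonMax (flip R) A x r

theorem Matched.symm {R : C₀(X, ℂ) → C₀(Y, ℂ) → Prop} {A : Set C₀(X, ℂ)} {B : Set C₀(Y, ℂ)}
    {P : Set X} {Q : Set Y} {x : X} {y : Y} (h : Matched R A B P Q x y) :
    Matched (flip R) B A Q P y x :=
  ⟨h.right_mem, h.left_mem, h.mem_right, h.mem_left⟩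

namespace IsCoupling

variable {k : RhoKind} {φ : C(ℂ × ℂ, ℝ)} {A : Set C₀(X, ℂ)} {B : Set C₀(Y, ℂ)}
  {R : C₀(X, ℂ) → C₀(Y, ℂ) → Prop} {P : Set X} {Q : Set Y}

theorem symm (hR : IsCoupling k φ A B R) : IsCoupling k φ B A (flip R) where
  mem_left h := hR.mem_right h
  mem_right h := hR.mem_left h
  total_left := hR.total_right
  total_right := hR.total_left
  rho_eq h h' := (hR.rho_eq h h').symm

theorem norm_le (hφ0 : ∀ p, 0 ≤ φ p) (hφ : IsInc φ) (hR : IsCoupling k φ A B R)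
    (hB : IsPeaking B Q) {f : C₀(X, ℂ)} {g : C₀(Y, ℂ)} (h : R f g) : ‖g‖ ≤ ‖f‖ := by
  by_contra! hlt
  have hg : 0 < ‖g‖ := (norm_nonneg f).trans_lt hlt
  obtain ⟨y, -, hy⟩ := hB.exists_max g (hR.mem_right h) hg.ne'
  have key := hφ.onReal_lt_left (norm_nonneg f) hlt (norm_nonneg f) hlt.le hg
  refine (rho_lt hφ0 hφ k (f := f.toBCF) (g := f.toBCF) (f' := g.toBCF) (g' := g.toBCF)
    (fun x => Or.inl ⟨norm_apply_le f x, norm_apply_le f x⟩) hy hy key key key key).ne ?_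
  exact (hR.rho_eq h h).symm

theorem norm_eq (hφ0 : ∀ p, 0 ≤ φ p) (hφ : IsInc φ) (hR : IsCoupling k φ A B R)
    (hA : IsPeaking A P) (hB : IsPeaking B Q) {f : C₀(X, ℂ)} {g : C₀(Y, ℂ)} (h : R f g) :
    ‖g‖ = ‖f‖ :=
  le_antisymm (hR.norm_le hφ0 hφ hB h) (hR.symm.norm_le hφ0 hφ hA h)

/-- If `|f x| < ‖f‖`, a peak `p` at `x` of height `‖f‖`, small where `|f|` is near `‖f‖`, gives
`ρ(f, p) < ρ(h, p)`, as `h` and `p` both attain `‖f‖` at `x`. On the other side, domination gives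
the opposite inequality. -/
theorem mem_maxSet_of_dominated (hφ0 : ∀ p, 0 ≤ φ p) (hφ : IsInc φ) (hR : IsCoupling k φ A B R)
    (hA : IsPeaking A P) {f h : C₀(X, ℂ)} {g g' : C₀(Y, ℂ)} (hf : R f g) (hh : R h g')
    (hnorm : ‖h‖ = ‖f‖) (hgg : ∀ z, ‖g' z‖ ≤ ‖g z‖) {x : X} (hx : x ∈ P) (hxh : x ∈ maxSet h) :
    x ∈ maxSet f := by
  by_contra hxf
  have hlt : ‖f x‖ < ‖f‖ := (norm_apply_le f x).lt_of_ne hxf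
  obtain ⟨c, hc₁, hc₂⟩ := exists_between hlt
  have hc : 0 ≤ c := (norm_nonneg _).trans hc₁.le
  have hf0 : 0 < ‖f‖ := hc.trans_lt hc₂
  obtain ⟨p, ⟨hpA, hpx, hpn⟩, hpV⟩ := hA.peak x hx ‖f‖ hf0 (‖f‖ / 2) (half_pos hf0) {z | ‖f z‖ < c}
    ((isOpen_lt f.continuous.norm continuous_const).mem_nhds hc₁)
  obtain ⟨q, hpq⟩ := hR.total_left p hpA
  have hhx : ‖h x‖ = ‖f‖ := (show ‖h x‖ = ‖h‖ from hxh).trans hnorm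
  have key : rho k φ f.toBCF p.toBCF < rho k φ h.toBCF p.toBCF := by
    refine rho_lt hφ0 hφ k (a := c) (b := ‖f‖) (a' := ‖f‖) (b' := ‖f‖ / 2) (fun z => ?_) hhx hpx
      (hφ.onReal_lt_left hc hc₂ hf0.le le_rfl hf0)
      (hφ.onReal_lt_right hf0.le le_rfl hf0 (half_pos hf0).le (half_lt_self hf0))
      (hφ.onReal_lt_right hf0.le le_rfl hf0 hc hc₂)
      (hφ.onReal_lt_left (half_pos hf0).le (half_lt_self hf0) hf0.le le_rfl hf0)
    by_cases hz : ‖f z‖ < c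
    · exact Or.inl ⟨hz.le, hpn ▸ norm_apply_le p z⟩
    · exact Or.inr ⟨norm_apply_le f z, (hpV z hz).le⟩
  refine key.not_ge ?_
  rw [← hR.rho_eq hh hpq, ← hR.rho_eq hf hpq]
  exact rho_mono hφ0 hφ k _ hgg

theorem exists_mem_commonMax (hφ0 : ∀ p, 0 ≤ φ p) (hφ : IsInc φ) (hR : IsCoupling k φ A B R)
    (hA : IsPeaking A P) (hB : IsPeaking B Q) {y : Y} (hy : y ∈ Q) {r : ℝ} (hr : 0 < r) :
    ∃ x ∈ P, x ∈ commonMax R B y r := by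
  set H : Set C₀(X, ℂ) := {f | ∃ g ∈ normAtSet B y r, R f g} with hH
  have hHA : H ⊆ A := fun f ⟨g, _, h⟩ => hR.mem_left h
  have hHn : ∀ f ∈ H, ‖f‖ = r := fun f ⟨g, hg, h⟩ =>
    (hR.norm_eq hφ0 hφ hA hB h).symm.trans hg.2.2
  obtain ⟨g₀, hg₀, -⟩ := hB.peak y hy r hr 1 one_pos Set.univ Filter.univ_mem
  obtain ⟨f₀, hf₀⟩ := hR.total_right g₀ hg₀.1
  have hf₀H : f₀ ∈ H := ⟨g₀, hg₀, hf₀⟩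
  -- Only points of `P` are tracked, since the domination lemma requires a peak at the point.
  have hdir : ∀ u : Finset H, ∃ h ∈ H, ∀ x ∈ P, x ∈ maxSet h →
      x ∈ maxSet f₀ ∧ ∀ f ∈ u, x ∈ maxSet (f : C₀(X, ℂ)) := by
    classical
    intro u
    induction u using Finset.induction_on with
    | empty => exact ⟨f₀, hf₀H, fun x _ hx => ⟨hx, by simp⟩⟩
    | insert f u _ ih =>
      obtain ⟨h, hh, hu⟩ := ih
      obtain ⟨g₁, hg₁, hhg₁⟩ := hh
      obtain ⟨g₂, hg₂, hfg₂⟩ := f.2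
      obtain ⟨g, hg, hgg₁, hgg₂⟩ := hB.exists_dominated hr hg₁ hg₂
      obtain ⟨h', hh'⟩ := hR.total_right g hg.1
      have hh'H : h' ∈ H := ⟨g, hg, hh'⟩
      refine ⟨h', hh'H, fun x hx hxh' => ?_⟩
      have h₁ : x ∈ maxSet h := hR.mem_maxSet_of_dominated hφ0 hφ hA hhg₁ hh'
        ((hHn _ hh'H).trans (hHn _ ⟨g₁, hg₁, hhg₁⟩).symm) hgg₁ hx hxh'
      have h₂ : x ∈ maxSet (f : C₀(X, ℂ)) := hR.mem_maxSet_of_dominated hφ0 hφ hA hfg₂ hh'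
        ((hHn _ hh'H).trans (hHn _ f.2).symm) hgg₂ hx hxh'
      refine ⟨(hu x hx h₁).1, fun f' hf' => ?_⟩
      rcases Finset.mem_insert.1 hf' with rfl | hf'
      · exact h₂
      · exact (hu x hx h₁).2 f' hf'
  have hne : (maxSet f₀ ∩ ⋂ f : H, maxSet (f : C₀(X, ℂ))).Nonempty := by
    refine (isCompact_maxSet ((hHn f₀ hf₀H).trans_ne hr.ne')).inter_iInter_nonempty _
      (fun f => isClosed_maxSet _) fun u => ?_
    obtain ⟨h, hh, hu⟩ := hdir u
    obtain ⟨x, hx, hxh⟩ := hA.exists_max h (hHA hh) ((hHn h hh).trans_ne hr.ne')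
    exact ⟨x, (hu x hx hxh).1, Set.mem_iInter₂.2 (hu x hx hxh).2⟩
  obtain ⟨x₀, -, hx₀⟩ := hne
  -- Compactness yields a common point `x₀` that may lie outside `P`; it is exchanged for one in
  -- `P`.
  obtain ⟨x, hx, hxH⟩ := hA.exists_common_max H hHA ⟨f₀, hf₀H, (hHn f₀ hf₀H).trans_ne hr.ne'⟩
    ⟨x₀, fun f hf => Set.mem_iInter.1 hx₀ ⟨f, hf⟩⟩
  exact ⟨x, hx, fun f g hfg hg => hxH f ⟨g, hg, hfg⟩⟩

/-- A function peaking at `y` with modulus below `r` at `y'` has a preimage attaining `r` at `x`,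
which would force it to attain its norm at `y'`. -/
theorem eq_of_mem_commonMax [T2Space Y] (hφ0 : ∀ p, 0 ≤ φ p) (hφ : IsInc φ)
    (hR : IsCoupling k φ A B R) (hA : IsPeaking A P) (hB : IsPeaking B Q) {x : X} {y y' : Y}
    (hy : y ∈ Q) {r : ℝ} (hr : 0 < r) (hx : x ∈ commonMax R B y r)
    (hy' : y' ∈ commonMax (flip R) A x r) : y' = y := by
  by_contra hne
  obtain ⟨g, hg, hgV⟩ := hB.peak y hy r hr r hr {y'}ᶜ (isOpen_compl_singleton.mem_nhds (Ne.symm hne))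
  obtain ⟨f, hf⟩ := hR.total_right g hg.1
  have hn : ‖f‖ = r := (hR.norm_eq hφ0 hφ hA hB hf).symm.trans hg.2.2
  have h₁ : y' ∈ maxSet g := hy' g f hf
    ⟨hR.mem_left hf, (show ‖f x‖ = ‖f‖ from hx f g hf hg).trans hn, hn⟩
  exact (hgV y' (by simp)).ne ((show ‖g y'‖ = ‖g‖ from h₁).trans hg.2.2)

theorem mem_commonMax_flip [T2Space Y] (hφ0 : ∀ p, 0 ≤ φ p) (hφ : IsInc φ)
    (hR : IsCoupling k φ A B R) (hA : IsPeaking A P) (hB : IsPeaking B Q) {x : X} {y : Y}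
    (hxP : x ∈ P) (hy : y ∈ Q) {r : ℝ} (hr : 0 < r) (hx : x ∈ commonMax R B y r) :
    y ∈ commonMax (flip R) A x r := by
  obtain ⟨y', -, hy'⟩ := hR.symm.exists_mem_commonMax hφ0 hφ hB hA hxP hr
  exact hR.eq_of_mem_commonMax hφ0 hφ hA hB hy hr hx hy' ▸ hy'

theorem mem_normAtSet (hφ0 : ∀ p, 0 ≤ φ p) (hφ : IsInc φ) (hR : IsCoupling k φ A B R)
    (hA : IsPeaking A P) (hB : IsPeaking B Q) {x : X} {y : Y} {r : ℝ}
    (hy : y ∈ commonMax (flip R) A x r) {f : C₀(X, ℂ)} {g : C₀(Y, ℂ)} (hfg : R f g)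
    (hf : f ∈ normAtSet A x r) : g ∈ normAtSet B y r := by
  have hn : ‖g‖ = r := (hR.norm_eq hφ0 hφ hA hB hfg).trans hf.2.2
  exact ⟨hR.mem_right hfg, (show ‖g y‖ = ‖g‖ from hy g f hfg hf).trans hn, hn⟩

/-- The point induced by `y` does not depend on the height. -/
theorem eq_of_mem_commonMax_of_mem_commonMax [T2Space X] [T2Space Y] (hφ0 : ∀ p, 0 ≤ φ p)
    (hφ : IsInc φ) (hR : IsCoupling k φ A B R) (hA : IsPeaking A P) (hB : IsPeaking B Q)
    {x x' : X} {y : Y} (hxP : x ∈ P) (hxP' : x' ∈ P) (hy : y ∈ Q) {r s : ℝ} (hr : 0 < r)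
    (hs : 0 < s) (hx : x ∈ commonMax R B y r) (hx' : x' ∈ commonMax R B y s) : x = x' := by
  by_contra hne
  obtain ⟨U, V, hU, hV, hxU, hxV, hUV⟩ := t2_separation hne
  -- With `ε` below both heights, the peaks at `x` and `x'` are never large together, whereas their
  -- images attain `r` and `s` at the same point `y`.
  obtain ⟨ε, hε, hεrs⟩ := exists_between (lt_min hr hs)
  obtain ⟨hεr, hεs⟩ := lt_min_iff.1 hεrs
  obtain ⟨f, hf, hfU⟩ := hA.peak x hxP r hr ε hε U (hU.mem_nhds hxU)
  obtain ⟨f', hf', hfV⟩ := hA.peak x' hxP' s hs ε hε V (hV.mem_nhds hxV)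
  obtain ⟨g, hg⟩ := hR.total_left f hf.1
  obtain ⟨g', hg'⟩ := hR.total_left f' hf'.1
  have hgy := hR.mem_normAtSet hφ0 hφ hA hB
    (hR.mem_commonMax_flip hφ0 hφ hA hB hxP hy hr hx) hg hf
  have hgy' := hR.mem_normAtSet hφ0 hφ hA hB
    (hR.mem_commonMax_flip hφ0 hφ hA hB hxP' hy hs hx') hg' hf'
  refine (rho_lt hφ0 hφ k (f := f.toBCF) (g := f'.toBCF) (f' := g.toBCF) (g' := g'.toBCF)
    (a := r) (b := ε) (a' := ε) (b' := s) (fun z => ?_) hgy.2.1 hgy'.2.1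
    (hφ.onReal_lt_right hr.le le_rfl hr hε.le hεs) (hφ.onReal_lt_left hε.le hεr hs.le le_rfl hs)
    (hφ.onReal_lt_left hε.le hεs hr.le le_rfl hr)
    (hφ.onReal_lt_right hs.le le_rfl hs hε.le hεr)).ne (hR.rho_eq hg hg').symm
  by_cases hz : z ∈ U
  · exact Or.inl ⟨hf.2.2 ▸ norm_apply_le f z, (hfV z (Set.disjoint_left.1 hUV hz)).le⟩
  · exact Or.inr ⟨(hfU z hz).le, hf'.2.2 ▸ norm_apply_le f' z⟩

theorem exists_matched [T2Space X] [T2Space Y] (hφ0 : ∀ p, 0 ≤ φ p) (hφ : IsInc φ)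
    (hR : IsCoupling k φ A B R) (hA : IsPeaking A P) (hB : IsPeaking B Q) {y : Y} (hy : y ∈ Q) :
    ∃ x, Matched R A B P Q x y := by
  obtain ⟨x, hxP, hx⟩ := hR.exists_mem_commonMax hφ0 hφ hA hB hy one_pos
  have hall : ∀ r : ℝ, 0 < r → x ∈ commonMax R B y r := fun r hr => by
    obtain ⟨x', hxP', hx'⟩ := hR.exists_mem_commonMax hφ0 hφ hA hB hy hr
    rwa [hR.eq_of_mem_commonMax_of_mem_commonMax hφ0 hφ hA hB hxP hxP' hy one_pos hr hx hx']
  exact ⟨x, hxP, hy, hall, fun r hr => hR.mem_commonMax_flip hφ0 hφ hA hB hxP hy hr (hall r hr)⟩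

theorem commonMax_inter_eq_singleton [T2Space X] (hφ0 : ∀ p, 0 ≤ φ p) (hφ : IsInc φ)
    (hR : IsCoupling k φ A B R) (hA : IsPeaking A P) (hB : IsPeaking B Q) {x : X} {y : Y}
    (h : Matched R A B P Q x y) {r : ℝ} (hr : 0 < r) : commonMax R B y r ∩ P = {x} := by
  refine Set.eq_singleton_iff_unique_mem.2 ⟨⟨h.mem_left r hr, h.left_mem⟩, fun x' hx' => ?_⟩
  exact hR.symm.eq_of_mem_commonMax hφ0 hφ hB hA h.left_mem hr (h.mem_right r hr) hx'.1

/-! ### Recovering moduli, and the homeomorphism. -/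

theorem norm_apply_le_of_matched_max (hφ0 : ∀ p, 0 ≤ φ p) (hφ : IsInc φ)
    (hR : IsCoupling RhoKind.max φ A B R) (hA : IsPeaking A P) (hB : IsPeaking B Q) {x : X} {y : Y}
    (h : Matched R A B P Q x y) {f : C₀(X, ℂ)} {g : C₀(Y, ℂ)} (hfg : R f g) :
    ‖g y‖ ≤ ‖f x‖ := by
  by_contra! hlt
  obtain ⟨c, hc₁, hc₂⟩ := exists_between hlt
  have hc : 0 ≤ c := (norm_nonneg _).trans hc₁.le
  have hg0 : 0 < ‖g y‖ := hc.trans_lt hc₂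
  have hf0 : 0 < ‖f‖ :=
    hg0.trans_le ((norm_apply_le g y).trans_eq (hR.norm_eq hφ0 hφ hA hB hfg))
  -- With peak height `‖f‖`, the off-peak bound `φ(‖f‖, ‖g y‖ / 2)` is below `φ(‖f‖, ‖g y‖)`, a
  -- value of the swapped pair `φ(q, g)` at `y` up to moduli.
  obtain ⟨p, hp, hpV⟩ := hA.peak x h.left_mem ‖f‖ hf0 (‖g y‖ / 2) (half_pos hg0) {z | ‖f z‖ < c}
    ((isOpen_lt f.continuous.norm continuous_const).mem_nhds hc₁)
  obtain ⟨q, hpq⟩ := hR.total_left p hp.1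
  have hq := hR.mem_normAtSet hφ0 hφ hA hB (h.mem_right _ hf0) hpq hp
  refine (rhoMax_lt hφ0 hφ (f := f.toBCF) (g := p.toBCF) (f' := g.toBCF) (g' := q.toBCF)
    (a := c) (b := ‖f‖) (a' := ‖f‖) (b' := ‖g y‖ / 2) (fun z => ?_) rfl hq.2.1
    (hφ.onReal_lt_left hc hc₂ hf0.le le_rfl hf0)
    (hφ.onReal_lt_right hf0.le le_rfl hf0 (half_pos hg0).le (half_lt_self hg0))
    (hφ.onReal_lt_right hf0.le le_rfl hf0 hc hc₂)
    (hφ.onReal_lt_left (half_pos hg0).le (half_lt_self hg0) hf0.le le_rfl hf0)).ne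
    (hR.rho_eq hfg hpq).symm
  by_cases hz : ‖f z‖ < c
  · exact Or.inl ⟨hz.le, hp.2.2 ▸ norm_apply_le p z⟩
  · exact Or.inr ⟨norm_apply_le f z, (hpV z hz).le⟩

/-- In `hsep`, `r` is the height of the peak and `ε` its size off the neighborhood; the condition
makes the off-peak values of `φ` smaller than the value at `y`, in both orders. -/
theorem norm_apply_le_of_matched (hφ0 : ∀ p, 0 ≤ φ p) (hφ : IsInc φ)
    (hsep : ∀ N b : ℝ, 0 ≤ N → 0 < b → ∃ r : ℝ, 0 < r ∧ ∃ ε : ℝ, 0 < ε ∧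
      onReal φ N ε < onReal φ b r ∧ onReal φ ε N < onReal φ r b)
    (hR : IsCoupling k φ A B R) (hA : IsPeaking A P) (hB : IsPeaking B Q) {x : X} {y : Y}
    (h : Matched R A B P Q x y) {f : C₀(X, ℂ)} {g : C₀(Y, ℂ)} (hfg : R f g) :
    ‖g y‖ ≤ ‖f x‖ := by
  by_contra! hlt
  obtain ⟨c, hc₁, hc₂⟩ := exists_between hlt
  have hc : 0 ≤ c := (norm_nonneg _).trans hc₁.le
  obtain ⟨r, hr, ε, hε, hsep₁, hsep₂⟩ := hsep ‖f‖ ‖g y‖ (norm_nonneg f) (hc.trans_lt hc₂)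
  obtain ⟨p, hp, hpV⟩ := hA.peak x h.left_mem r hr ε hε {z | ‖f z‖ < c}
    ((isOpen_lt f.continuous.norm continuous_const).mem_nhds hc₁)
  obtain ⟨q, hpq⟩ := hR.total_left p hp.1
  have hq := hR.mem_normAtSet hφ0 hφ hA hB (h.mem_right _ hr) hpq hp
  refine (rho_lt hφ0 hφ k (f := f.toBCF) (g := p.toBCF) (f' := g.toBCF) (g' := q.toBCF)
    (a := c) (b := r) (a' := ‖f‖) (b' := ε) (fun z => ?_) rfl hq.2.1
    (hφ.onReal_lt_left hc hc₂ hr.le le_rfl hr) hsep₁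
    (hφ.onReal_lt_right hr.le le_rfl hr hc hc₂) hsep₂).ne (hR.rho_eq hfg hpq).symm
  by_cases hz : ‖f z‖ < c
  · exact Or.inl ⟨hz.le, hp.2.2 ▸ norm_apply_le p z⟩
  · exact Or.inr ⟨norm_apply_le f z, (hpV z hz).le⟩

/-- If `f` peaks at `Φ y` inside `V`, the open set where its partner exceeds `1 / 2` is mapped into
`V`. -/
theorem continuous_of_norm_apply_eq (hR : IsCoupling k φ A B R) (hA : IsPeaking A P) {Φ : Q → P}
    (hΦ : ∀ f g, R f g → ∀ y : Q, ‖g y‖ = ‖f (Φ y)‖) : Continuous Φ := by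
  refine continuous_induced_rng.2 (continuous_iff_continuousAt.2 fun y => ?_)
  intro V hV
  obtain ⟨f, hf, hfV⟩ := hA.peak (Φ y) (Φ y).2 1 one_pos (1 / 2) one_half_pos V hV
  obtain ⟨g, hg⟩ := hR.total_left f hf.1
  have hopen : IsOpen {y' : Q | 1 / 2 < ‖g y'‖} :=
    isOpen_lt continuous_const (g.continuous.comp continuous_subtype_val).norm
  refine Filter.mem_map.2 (Filter.mem_of_superset (hopen.mem_nhds ?_) fun y' hy' => ?_)
  · show 1 / 2 < ‖g y‖
    rw [hΦ f g hg y, hf.2.1]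
    norm_num
  · by_contra hV'
    have h₁ : 1 / 2 < ‖g y'‖ := hy'
    rw [hΦ f g hg y'] at h₁
    exact (hfV _ hV').not_gt h₁

theorem isHomeomorph_of_norm_apply_eq (hR : IsCoupling k φ A B R) (hA : IsPeaking A P)
    (hB : IsPeaking B Q) {Φ : Q → P} (hbij : Function.Bijective Φ)
    (hΦ : ∀ f g, R f g → ∀ y : Q, ‖g y‖ = ‖f (Φ y)‖) : IsHomeomorph Φ := by
  let e := Equiv.ofBijective Φ hbij
  have hinv : Continuous e.symm := hR.symm.continuous_of_norm_apply_eq hB fun g f hfg x => by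
    rw [hΦ f g hfg]
    exact congrArg (fun z : P => ‖f z‖) (e.apply_symm_apply x).symm
  exact isHomeomorph_iff_exists_inverse.2 ⟨hR.continuous_of_norm_apply_eq hA hΦ, e.symm,
    e.symm_apply_apply, e.apply_symm_apply, hinv⟩

end IsCoupling

/-- Height `1` works: as `ε → 0` the left sides tend to `0`, while the right sides are positive. -/
theorem exists_separating_heights_of_map_zero {φ : C(ℂ × ℂ, ℝ)} (hφ0 : ∀ p, 0 ≤ φ p)
    (hφ : IsInc φ) (h : ∀ t : ℝ, 0 ≤ t → φ ((t : ℂ), 0) = 0 ∧ φ (0, (t : ℂ)) = 0) {N b : ℝ}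
    (hN : 0 ≤ N) (hb : 0 < b) : ∃ r : ℝ, 0 < r ∧ ∃ ε : ℝ, 0 < ε ∧
      onReal φ N ε < onReal φ b r ∧ onReal φ ε N < onReal φ r b := by
  have hpos : ∀ s t : ℝ, 0 < s → 0 < t → 0 < onReal φ s t := fun s t hs ht =>
    (hφ0 _).trans_lt (hφ.onReal_lt_left le_rfl hs ht.le le_rfl ht)
  have h₁ : Filter.Tendsto (fun ε => onReal φ N ε) (nhdsWithin 0 (Set.Ioi 0)) (nhds 0) := by
    have hc : Continuous fun ε => onReal φ N ε :=
      continuous_onReal.comp (f := fun ε : ℝ => (N, ε)) (by fun_prop)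
    have h0 : onReal φ N 0 = 0 := by simpa [onReal] using (h N hN).1
    exact (h0 ▸ hc.tendsto 0).mono_left nhdsWithin_le_nhds
  have h₂ : Filter.Tendsto (fun ε => onReal φ ε N) (nhdsWithin 0 (Set.Ioi 0)) (nhds 0) := by
    have hc : Continuous fun ε => onReal φ ε N :=
      continuous_onReal.comp (f := fun ε : ℝ => (ε, N)) (by fun_prop)
    have h0 : onReal φ 0 N = 0 := by simpa [onReal] using (h N hN).2
    exact (h0 ▸ hc.tendsto 0).mono_left nhdsWithin_le_nhds
  obtain ⟨ε, ⟨hε₁, hε₂⟩, hε⟩ := ((h₁.eventually_lt_const (hpos b 1 hb one_pos)).and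
    (h₂.eventually_lt_const (hpos 1 b one_pos hb))).and self_mem_nhdsWithin |>.exists
  exact ⟨1, one_pos, ε, hε, hε₁, hε₂⟩

/-- Here `ε = 1` is fixed and the height `r` is taken large. -/
theorem exists_separating_heights_of_tendsto_atTop {φ : C(ℂ × ℂ, ℝ)}
    (h : ∀ a : ℝ, 0 < a →
      Filter.Tendsto (fun t : ℝ => φ ((t : ℂ), (a : ℂ))) Filter.atTop Filter.atTop ∧
      Filter.Tendsto (fun t : ℝ => φ ((a : ℂ), (t : ℂ))) Filter.atTop Filter.atTop) (N : ℝ) {b : ℝ}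
    (hb : 0 < b) : ∃ r : ℝ, 0 < r ∧ ∃ ε : ℝ, 0 < ε ∧
      onReal φ N ε < onReal φ b r ∧ onReal φ ε N < onReal φ r b := by
  obtain ⟨r, ⟨hr₁, hr₂⟩, hr⟩ := (((h b hb).2.eventually_gt_atTop (onReal φ N 1)).and
    ((h b hb).1.eventually_gt_atTop (onReal φ 1 N))).and (Filter.eventually_gt_atTop 0) |>.exists
  exact ⟨r, hr, 1, one_pos, hr₁, hr₂⟩

/-- The graph of a map between sets of functions. -/
def graphRel {A : Set C₀(X, ℂ)} {B : Set C₀(Y, ℂ)} (T : A → B) (f : C₀(X, ℂ)) (g : C₀(Y, ℂ)) :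
    Prop :=
  ∃ h : f ∈ A, (T ⟨f, h⟩ : C₀(Y, ℂ)) = g

theorem isCoupling_graphRel {k : RhoKind} {φ : C(ℂ × ℂ, ℝ)} {A : Set C₀(X, ℂ)}
    {B : Set C₀(Y, ℂ)} {T : A → B} (hTsurj : Function.Surjective T)
    (hT : ∀ f g : A, rho k φ (T f : C₀(Y, ℂ)).toBCF (T g : C₀(Y, ℂ)).toBCF =
      rho k φ (f : C₀(X, ℂ)).toBCF (g : C₀(X, ℂ)).toBCF) :
    IsCoupling k φ A B (graphRel T) where
  mem_left := fun ⟨h, _⟩ => h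
  mem_right := fun ⟨h, hg⟩ => hg ▸ (T ⟨_, h⟩).2
  total_left f hf := ⟨_, hf, rfl⟩
  total_right g hg := by
    obtain ⟨f, hf⟩ := hTsurj ⟨g, hg⟩
    exact ⟨f, f.2, congrArg Subtype.val hf⟩
  rho_eq := by
    rintro f _ f' _ ⟨hf, rfl⟩ ⟨hf', rfl⟩
    exact hT ⟨f, hf⟩ ⟨f', hf'⟩

theorem setI_eq_commonMax {A : Set C₀(X, ℂ)} {B : Set C₀(Y, ℂ)} (T : A → B) (y : Y) (r : ℝ) :
    setI T y r = commonMax (graphRel T) B y r := by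
  ext x
  constructor
  · rintro hx f _ ⟨hf, rfl⟩ hg
    exact hx ⟨f, hf⟩ hg
  · intro hx f hg
    exact hx f _ ⟨f.2, rfl⟩ hg

theorem setJ_eq_commonMax {A : Set C₀(X, ℂ)} {B : Set C₀(Y, ℂ)} (T : A → B) (x : X) (r : ℝ) :
    setJ T x r = commonMax (flip (graphRel T)) A x r := by
  ext y
  constructor
  · rintro hy _ f ⟨hf, rfl⟩ hg
    exact hy ⟨f, hf⟩ hg
  · intro hy f hg
    exact hy _ f ⟨f.2, rfl⟩ hg

end Coupling

end NormPreserving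

theorem theorem5
    {X Y : Type*} [TopologicalSpace X] [LocallyCompactSpace X] [T2Space X]
    [TopologicalSpace Y] [LocallyCompactSpace Y] [T2Space Y]
    (φ : C(ℂ × ℂ, ℝ)) (hφ_nonneg : ∀ p, 0 ≤ φ p) (hφ : NormPreserving.IsInc φ)
    (A : Set C₀(X, ℂ)) (B : Set C₀(Y, ℂ))
    (hA : NormPreserving.IsAdmissible A) (hB : NormPreserving.IsAdmissible B)
    (𝒜 : NonUnitalSubalgebra ℂ C₀(X, ℂ)) (ℬ : NonUnitalSubalgebra ℂ C₀(Y, ℂ))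
    (h𝒜 : NormPreserving.IsFunctionAlgebra 𝒜) (hℬ : NormPreserving.IsFunctionAlgebra ℬ)
    (hδA : NormPreserving.strongBoundary A = NormPreserving.choquetBoundary 𝒜.toSubmodule)
    (hδB : NormPreserving.strongBoundary B = NormPreserving.choquetBoundary ℬ.toSubmodule)
    (hA𝒜 : NormPreserving.modulusSet A ⊆ NormPreserving.modulusSet (𝒜 : Set C₀(X, ℂ)))
    (hBℬ : NormPreserving.modulusSet B ⊆ NormPreserving.modulusSet (ℬ : Set C₀(Y, ℂ)))
    (T : A → B) (hTsurj : Function.Surjective T)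
    (k : NormPreserving.RhoKind)
    (hT : ∀ f g : A,
      NormPreserving.rho k φ (T f : C₀(Y, ℂ)).toBCF (T g : C₀(Y, ℂ)).toBCF =
        NormPreserving.rho k φ (f : C₀(X, ℂ)).toBCF (g : C₀(X, ℂ)).toBCF) :
    ∃ Φ : NormPreserving.choquetBoundary ℬ.toSubmodule →
        NormPreserving.choquetBoundary 𝒜.toSubmodule,
      Function.Bijective Φ ∧ NormPreserving.Induces T Φ ∧
      (k = NormPreserving.RhoKind.max →
        IsHomeomorph Φ ∧
          ∀ (f : A) (y : NormPreserving.choquetBoundary ℬ.toSubmodule),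
            ‖(T f : C₀(Y, ℂ)) (y : Y)‖ = ‖(f : C₀(X, ℂ)) (Φ y : X)‖) ∧
      (k = NormPreserving.RhoKind.plus →
        ((∀ t : ℝ, 0 ≤ t → φ ((t : ℂ), 0) = 0 ∧ φ (0, (t : ℂ)) = 0) ∨
          (∀ a : ℝ, 0 < a →
            Filter.Tendsto (fun t : ℝ => φ ((t : ℂ), (a : ℂ))) Filter.atTop Filter.atTop ∧
            Filter.Tendsto (fun t : ℝ => φ ((a : ℂ), (t : ℂ))) Filter.atTop Filter.atTop)) →
        IsHomeomorph Φ ∧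
          ∀ (f : A) (y : NormPreserving.choquetBoundary ℬ.toSubmodule),
            ‖(T f : C₀(Y, ℂ)) (y : Y)‖ = ‖(f : C₀(X, ℂ)) (Φ y : X)‖) := by
  open NormPreserving in
  have hA' : IsPeaking A (choquetBoundary 𝒜.toSubmodule) := hA.isPeaking hδA.ge hA𝒜
  open NormPreserving in
  have hB' : IsPeaking B (choquetBoundary ℬ.toSubmodule) := hB.isPeaking hδB.ge hBℬ
  have hR := NormPreserving.isCoupling_graphRel hTsurj hT
  choose F hF using fun y : NormPreserving.choquetBoundary ℬ.toSubmodule =>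
    hR.exists_matched hφ_nonneg hφ hA' hB' y.2
  have hI := fun y {r : ℝ} (hr : 0 < r) =>
    hR.commonMax_inter_eq_singleton hφ_nonneg hφ hA' hB' (hF y) hr
  have hJ := fun y {r : ℝ} (hr : 0 < r) =>
    hR.symm.commonMax_inter_eq_singleton hφ_nonneg hφ hB' hA' (hF y).symm hr
  let Φ : NormPreserving.choquetBoundary ℬ.toSubmodule →
      NormPreserving.choquetBoundary 𝒜.toSubmodule := fun y => ⟨F y, (hF y).left_mem⟩
  -- Injectivity holds because `F y` determines `{y}` as its set of common maxima; surjectivity is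
  -- the existence of a match on the reversed side.
  have hbij : Function.Bijective Φ := by
    refine ⟨fun y y' hyy => ?_, fun x => ?_⟩
    · have h : F y = F y' := congrArg Subtype.val hyy
      have h₁ := hJ y one_pos
      rw [h, hJ y' one_pos] at h₁
      exact Subtype.ext (Set.singleton_injective h₁).symm
    · obtain ⟨y, hy⟩ := hR.symm.exists_matched hφ_nonneg hφ hB' hA' x.2
      refine ⟨⟨y, hy.left_mem⟩, Subtype.ext (Set.singleton_injective ?_)⟩
      exact (hI ⟨y, hy.left_mem⟩ one_pos).symm.trans
        (hR.commonMax_inter_eq_singleton hφ_nonneg hφ hA' hB' hy.symm one_pos)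
  have hconclude : (∀ f g, NormPreserving.graphRel T f g →
      ∀ y : NormPreserving.choquetBoundary ℬ.toSubmodule, ‖g y‖ = ‖f (Φ y)‖) →
      IsHomeomorph Φ ∧ ∀ (f : A) (y : NormPreserving.choquetBoundary ℬ.toSubmodule),
        ‖(T f : C₀(Y, ℂ)) (y : Y)‖ = ‖(f : C₀(X, ℂ)) (Φ y : X)‖ := fun h =>
    ⟨hR.isHomeomorph_of_norm_apply_eq hA' hB' hbij h, fun f y => h f _ ⟨f.2, rfl⟩ y⟩
  refine ⟨Φ, hbij, ⟨fun y r hr => ?_, fun y r hr => ?_⟩, ?_, ?_⟩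
  · rw [NormPreserving.setI_eq_commonMax]
    exact hI y hr
  · rw [NormPreserving.setJ_eq_commonMax]
    exact hJ y hr
  · rintro rfl
    exact hconclude fun f g hfg y => le_antisymm
      (hR.norm_apply_le_of_matched_max hφ_nonneg hφ hA' hB' (hF y) hfg)
      (hR.symm.norm_apply_le_of_matched_max hφ_nonneg hφ hB' hA' (hF y).symm hfg)
  · intro _ hab
    have hsep : ∀ N b : ℝ, 0 ≤ N → 0 < b → ∃ r : ℝ, 0 < r ∧ ∃ ε : ℝ, 0 < ε ∧
        NormPreserving.onReal φ N ε < NormPreserving.onReal φ b r ∧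
        NormPreserving.onReal φ ε N < NormPreserving.onReal φ r b := fun N b hN hb =>
      hab.elim
        (fun h => NormPreserving.exists_separating_heights_of_map_zero hφ_nonneg hφ h hN hb)
        (fun h => NormPreserving.exists_separating_heights_of_tendsto_atTop h N hb)
    exact hconclude fun f g hfg y => le_antisymm
      (hR.norm_apply_le_of_matched hφ_nonneg hφ hsep hA' hB' (hF y) hfg)
      (hR.symm.norm_apply_le_of_matched hφ_nonneg hφ hsep hB' hA' (hF y).symm hfg)
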